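/- Conventions. $\mathbb N_0=\{0,1,2,\dots\}$. A semigroup $S$ is inverse if every $x\in S$ has a unique $y\in S$ with $xyx=x$ and $yxy=y$. An inverse semigroup $S$ with zero $0$ is a $0$-bisimple $\omega$-semigroup if it has exactly two $\mathscr D$-classes, $S\setminus\{0\}$ and $\{0\}$, and its nonzero idempotents, ordered by $e\le f\iff ef=fe=e$, form a chain isomorphic to $\{0,-1,-2,\dots\}$. $S$ is semitopological if it carries a topology in which all left and right translations are continuous. The maximal subgroup at an idempotent $e$ is the $\mathscr H$-class of $e$, a group with identity $e$, with the subspace topology. For a group $G$ and a homomorphism $\theta\colon G\to G$, the Reilly semigroup $\mathbf B(G,\theta)$ is the set $\mathbb N_0\times G\times\mathbb N_0$ with $$(i,s,j)(m,t,n)=\bigl(i+m-k,\ \theta^{m-k}(s)\,\theta^{j-k}(t),\ j+n-k\bigr),\qquad k=\min\{j,m\},$$ and $\mathbf B(G,\theta)^0$ is $\mathbf B(G,\theta)$ with a zero $0$ adjoined. Put $G_{i,j}=\{i\}\times G\times\{j\}$ (these are the nonzero $\mathscr H$-classes), each given the topology of $G$ via $(i,g,j)\mapsto g$, when $G$ has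 a topology. On $\mathbf B(G,\theta)^0$ let $\tau^{\oplus}$ be the topology of the topological sum of all $G_{i,j}$ and $\{0\}$ (so each $G_{i,j}$ is open and closed and $0$ is isolated). Let $\tau^{\mathsf{Ac}}$ be the topology in which a set $U$ is open iff $U\cap G_{i,j}$ is open in $G_{i,j}$ for all $i,j$ and, if $0\in U$, then $G_{i,j}\subseteq U$ for all but finitely many $(i,j)$; for compact Hausdorff $G$ it is the one-point compactification of the topological sum of the $G_{i,j}$, with $0$ as the added point. **Theorem 3.13.** Let $S$ be a Hausdorff locally compact semitopological $0$-bisimple inverse $\omega$-semigroup, let $e\in S$ be a nonzero idempotent, and suppose that the maximal subgroup $G$ of $S$ at $e$ is compact. Then $G$ is a topological group, and there is a continuous homomorphism $\theta\colon G\to G$ such that $S$ is topologically isomorphic either to $(\mathbf B(G,\theta)^0,\tau^{\oplus})$ or to $(\mathbf B(G,\theta)^0,\tau^{\mathsf{Ac}})$. -/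

import Mathlib

/-- `S` is an inverse semigroup: every `x` has a unique `y` with `xyx = x` and `yxy = y`. -/
def IsInverseSemigroup (S : Type*) [Semigroup S] : Prop :=
  ∀ x : S, ∃! y : S, x * y * x = x ∧ y * x * y = y

section Green

variable {S : Type*} [Semigroup S]

/-- The principal left ideal `S¹x = {x} ∪ Sx`. -/
def principalLeftIdeal (x : S) : Set S := {y | y = x ∨ ∃ s, y = s * x}

/-- The principal right ideal `xS¹ = {x} ∪ xS`. -/
def principalRightIdeal (x : S) : Set S := {y | y = x ∨ ∃ s, y = x * s}

/-- Green's relation `𝓛`. -/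
def GreenL (x y : S) : Prop := principalLeftIdeal x = principalLeftIdeal y

/-- Green's relation `𝓡`. -/
def GreenR (x y : S) : Prop := principalRightIdeal x = principalRightIdeal y

/-- Green's relation `𝓗 = 𝓛 ∩ 𝓡`. -/
def GreenH (x y : S) : Prop := GreenL x y ∧ GreenR x y

/-- Green's relation `𝓓 = 𝓛 ∘ 𝓡`. -/
def GreenD (x y : S) : Prop := ∃ z, GreenL x z ∧ GreenR z y

/-- The maximal subgroup with identity `e`, i.e. the `𝓗`-class of the idempotent `e`. -/
def MaximalSubgroup {e : S} (_he : IsIdempotentElem e) : Type _ := {x : S // GreenH x e}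

/-- If `S` is a topological space, its maximal subgroups carry the subspace topology. -/
instance [TopologicalSpace S] {e : S} (he : IsIdempotentElem e) :
    TopologicalSpace (MaximalSubgroup he) :=
  inferInstanceAs (TopologicalSpace {x : S // GreenH x e})

theorem greenH_idem_iff {e : S} (he : IsIdempotentElem e) (x : S) :
    GreenH x e ↔ (e * x = x ∧ x * e = x) ∧ (∃ y, x * y = e) ∧ ∃ z, z * x = e := by
  have hee : e * e = e := he
  constructor
  · rintro ⟨hl, hr⟩
    have h1 : x ∈ principalLeftIdeal e := hl ▸ Or.inl rfl
    have h2 : e ∈ principalLeftIdeal x := hl ▸ Or.inl rfl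
    have h3 : x ∈ principalRightIdeal e := hr ▸ Or.inl rfl
    have h4 : e ∈ principalRightIdeal x := hr ▸ Or.inl rfl
    refine ⟨⟨?_, ?_⟩, ?_, ?_⟩
    · rcases h3 with rfl | ⟨s, rfl⟩
      · exact hee
      · rw [← mul_assoc, hee]
    · rcases h1 with rfl | ⟨s, rfl⟩
      · exact hee
      · rw [mul_assoc, hee]
    · rcases h4 with h | ⟨s, h⟩
      · exact ⟨e, by rw [← h, hee]⟩
      · exact ⟨s, h.symm⟩
    · rcases h2 with h | ⟨s, h⟩
      · exact ⟨e, by rw [← h, hee]⟩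
      · exact ⟨s, h.symm⟩
  · rintro ⟨⟨h1, h2⟩, ⟨y, hy⟩, ⟨z, hz⟩⟩
    constructor
    · ext w
      constructor
      · rintro (rfl | ⟨s, rfl⟩)
        · exact Or.inr ⟨w, h2.symm⟩
        · exact Or.inr ⟨s * x, by rw [mul_assoc, h2]⟩
      · rintro (rfl | ⟨s, rfl⟩)
        · exact Or.inr ⟨z, hz.symm⟩
        · exact Or.inr ⟨s * z, by rw [mul_assoc, hz]⟩
    · ext w
      constructor
      · rintro (rfl | ⟨s, rfl⟩)
        · exact Or.inr ⟨w, h1.symm⟩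
        · exact Or.inr ⟨x * s, by rw [← mul_assoc, h1]⟩
      · rintro (rfl | ⟨s, rfl⟩)
        · exact Or.inr ⟨y, hy.symm⟩
        · exact Or.inr ⟨y * s, by rw [← mul_assoc, hy]⟩

theorem exists_inverse_in_maximalSubgroup {e : S} (he : IsIdempotentElem e)
    (x : MaximalSubgroup he) : ∃ y : MaximalSubgroup he, y.1 * x.1 = e := by
  have hee : e * e = e := he
  obtain ⟨x, hx⟩ := x
  obtain ⟨⟨h1, h2⟩, ⟨y, hy⟩, ⟨z, hz⟩⟩ := (greenH_idem_iff he x).1 hx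
  have hxy : x * (e * y * e) = e := by
    rw [← mul_assoc, ← mul_assoc, h2, hy, hee]
  have hey : e * (e * y * e) = e * y * e := by rw [← mul_assoc, ← mul_assoc, hee]
  have hye : e * y * e * e = e * y * e := by rw [mul_assoc, hee]
  have hyx : e * y * e * x = e := by
    calc e * y * e * x = z * x * (e * y * e) * x := by rw [hz, hey]
      _ = z * (x * (e * y * e)) * x := by simp only [mul_assoc]
      _ = z * x := by rw [hxy, mul_assoc, h1]
      _ = e := hz
  exact ⟨⟨e * y * e, (greenH_idem_iff he _).2 ⟨⟨hey, hye⟩, ⟨x, hyx⟩, ⟨x, hxy⟩⟩⟩, hyx⟩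

instance {e : S} (he : IsIdempotentElem e) : Mul (MaximalSubgroup he) where
  mul x y := ⟨x.1 * y.1, by
    obtain ⟨⟨h1, h2⟩, ⟨u, hu⟩, ⟨v, hv⟩⟩ := (greenH_idem_iff he x.1).1 x.2
    obtain ⟨⟨k1, k2⟩, ⟨w, hw⟩, ⟨z, hz⟩⟩ := (greenH_idem_iff he y.1).1 y.2
    refine (greenH_idem_iff he _).2 ⟨⟨?_, ?_⟩, ⟨w * u, ?_⟩, ⟨z * v, ?_⟩⟩
    · rw [← mul_assoc, h1]
    · rw [mul_assoc, k2]
    · rw [mul_assoc, ← mul_assoc y.1, hw, ← mul_assoc, h2, hu]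
    · rw [mul_assoc, ← mul_assoc v, hv, k1, hz]⟩

/-- The maximal subgroup at `e` is a group under the multiplication of `S`, with identity `e`. -/
noncomputable instance {e : S} (he : IsIdempotentElem e) : Group (MaximalSubgroup he) :=
  letI : One (MaximalSubgroup he) := ⟨⟨e, rfl, rfl⟩⟩
  letI : Inv (MaximalSubgroup he) := ⟨fun x => (exists_inverse_in_maximalSubgroup he x).choose⟩
  Group.ofLeftAxioms
    (fun x y z => Subtype.ext (mul_assoc x.1 y.1 z.1))
    (fun x => Subtype.ext ((greenH_idem_iff he x.1).1 x.2).1.1)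
    (fun x => Subtype.ext (exists_inverse_in_maximalSubgroup he x).choose_spec)

end Green

/-- An inverse semigroup `S` with zero is a `0`-bisimple `ω`-semigroup: its `𝓓`-classes are exactly
`S \ {0}` and `{0}`, and the nonzero idempotents, with the natural partial order
`e ≤ f ↔ ef = fe = e`, form a chain isomorphic to `{0, -1, -2, …}` (enumerated in decreasing order
by `c 0 > c 1 > c 2 > ⋯`). -/
structure IsZeroBisimpleInverseOmegaSemigroup (S : Type*) [SemigroupWithZero S] : Prop where
  inverse : IsInverseSemigroup S
  exists_ne_zero : ∃ x : S, x ≠ 0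
  greenD_iff : ∀ x y : S, GreenD x y ↔ (x = 0 ↔ y = 0)
  omega_chain : ∃ c : ℕ ≃ {e : S // IsIdempotentElem e ∧ e ≠ 0}, ∀ m n : ℕ,
    m ≤ n ↔ ((c n).1 * (c m).1 = (c n).1 ∧ (c m).1 * (c n).1 = (c n).1)

/-- The underlying set `ℕ × G × ℕ` of the Reilly semigroup `B(G, θ)`, i.e. the Bruck–Reilly
extension of the group `G` by the endomorphism `θ`. -/
@[ext]
structure ReillySemigroup {G : Type*} [Group G] (θ : G →* G) where
  left : ℕ
  mid : G
  right : ℕ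

namespace ReillySemigroup

variable {G : Type*} [Group G] (θ : G →* G)

instance : Mul (ReillySemigroup θ) where
  mul x y :=
    ⟨x.left + y.left - min x.right y.left,
     θ^[y.left - min x.right y.left] x.mid * θ^[x.right - min x.right y.left] y.mid,
     x.right + y.right - min x.right y.left⟩

theorem mul_def (x y : ReillySemigroup θ) : x * y =
    ⟨x.left + y.left - min x.right y.left,
     θ^[y.left - min x.right y.left] x.mid * θ^[x.right - min x.right y.left] y.mid,
     x.right + y.right - min x.right y.left⟩ := rfl

instance : Semigroup (ReillySemigroup θ) where
  mul_assoc x y z := by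
    obtain ⟨i, s, j⟩ := x
    obtain ⟨m, t, n⟩ := y
    obtain ⟨p, u, q⟩ := z
    simp only [mul_def, mk.injEq, iterate_map_mul, ← Function.iterate_add_apply]
    refine ⟨by omega, ?_, by omega⟩
    rw [mul_assoc]
    refine congrArg₂ (· * ·) ?_ (congrArg₂ (· * ·) ?_ ?_)
    · exact congrArg (fun k => θ^[k] s) (by omega)
    · exact congrArg (fun k => θ^[k] t) (by omega)
    · exact congrArg (fun k => θ^[k] u) (by omega)

variable [TopologicalSpace G]

/-- The trace of a subset `U` of `B(G, θ)⁰` on `G_{i,j}`, viewed as a subset of `G`. -/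
def slice (U : Set (WithZero (ReillySemigroup θ))) (i j : ℕ) : Set G :=
  {g | ((⟨i, g, j⟩ : ReillySemigroup θ) : WithZero (ReillySemigroup θ)) ∈ U}

/-- The topology `τ^⊕` on `B(G, θ)⁰`: the sets `{(i, g, j) | g ∈ U}` with `U` open in `G`, together
with `{0}`, form a base; equivalently `U` is open iff each of its traces on the `G_{i,j}` is. -/
abbrev sumTopology : TopologicalSpace (WithZero (ReillySemigroup θ)) where
  IsOpen U := ∀ i j, IsOpen (slice θ U i j)
  isOpen_univ _ _ := isOpen_univ
  isOpen_inter _ _ hU hV i j := (hU i j).inter (hV i j)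
  isOpen_sUnion F hF i j := by
    have : slice θ (⋃₀ F) i j = ⋃ U ∈ F, slice θ U i j := by
      ext g; simp [slice]
    rw [this]
    exact isOpen_biUnion fun U hU => hF U hU i j

/-- The topology `τ^Ac` on `B(G, θ)⁰`: a set is open iff each of its traces on the `G_{i,j}` is open
and, in case it contains `0`, it contains all but finitely many of the `G_{i,j}`. For compact `G`
this is the one-point compactification, with `0` at infinity, of the topological sum of the
`G_{i,j}`. -/
abbrev acTopology : TopologicalSpace (WithZero (ReillySemigroup θ)) where
  IsOpen U := (∀ i j, IsOpen (slice θ U i j)) ∧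
    (0 ∈ U → {p : ℕ × ℕ | slice θ U p.1 p.2 ≠ Set.univ}.Finite)
  isOpen_univ := ⟨fun _ _ => isOpen_univ, fun _ => by simp [slice]⟩
  isOpen_inter U V hU hV := ⟨fun i j => (hU.1 i j).inter (hV.1 i j), fun h0 => by
    refine ((hU.2 h0.1).union (hV.2 h0.2)).subset fun p hp => ?_
    by_contra hcon
    simp only [Set.mem_union, Set.mem_ofPred_eq, not_or, not_not] at hcon
    refine hp (Set.eq_univ_of_forall fun g => ⟨?_, ?_⟩)
    · exact (Set.eq_univ_iff_forall.1 hcon.1) g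
    · exact (Set.eq_univ_iff_forall.1 hcon.2) g⟩
  isOpen_sUnion F hF := by
    refine ⟨fun i j => ?_, ?_⟩
    · have : slice θ (⋃₀ F) i j = ⋃ U ∈ F, slice θ U i j := by
        ext g; simp [slice]
      rw [this]
      exact isOpen_biUnion fun U hU => (hF U hU).1 i j
    · rintro ⟨U, hU, h0⟩
      refine ((hF U hU).2 h0).subset fun p hp hcon => hp ?_
      exact Set.eq_univ_of_forall fun g =>
        Set.mem_sUnion.2 ⟨U, hU, (Set.eq_univ_iff_forall.1 hcon) g⟩

end ReillySemigroup

/-!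
The maximal subgroup `G` is a compact Hausdorff group with separately continuous multiplication,
hence a topological group (`isTopologicalGroup_of_compactSpace`). This special case of Ellis'
theorem is proved by showing that the left translates of a continuous function on `G` depend
norm-continuously on the translating element (`continuous_comp_mulLeft`). That is a consequence of
Baire's theorem once the set of translates is norm-separable, and separability follows from the
case of the closed subgroups that have a countable dense subset.

Algebraically, `S` is `B(G, θ)⁰` by Reilly's theorem
(`IsZeroBisimpleInverseOmegaSemigroup.exists_reilly_equiv`). The largest idempotent is an identity
`1`, and there are `p`, `q` with `p * q = 1` such that the nonzero idempotents are the products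
`q ^ n * p ^ n`. Every nonzero element is `q ^ i * u * p ^ j` for exactly one triple of `i`, `j` and
a unit `u`. Multiplication has the Reilly form because `p * u = (p * u * q) * p`, units commuting
with idempotents as an `ω`-chain has no nontrivial automorphisms (`IsOmegaChain.conj`).

Topologically, the `𝓗`-classes `G_{i,j}` are compact, and open
(`ReillySemigroup.isBlockDecomposition`), so only the neighbourhoods of `0` are in question
(`ReillySemigroup.singleton_zero_mem_nhds_or`). Let `U` be a compact one. For any other
neighbourhood `W`, the compact set `U \ interior W` meets only finitely many `G_{i,j}`. With `W` the
preimage of `U` under the translations by `p` and `q` this shows that the traces of `U` on adjacent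
`G_{i,j}`, viewed in `G`, agree up to finitely many exceptions. A grid without a finite square is
connected, so almost all traces are one set `A ⊆ G`. Translating row `0` by `(0, h, 0)` gives
`h A ⊆ A` for every `h`, so `A` is empty, and `0` is isolated, or `A = G`, and every neighbourhood
of `0` contains almost all `G_{i,j}`.
-/

open Set Filter Topology

/-! ### Compact semitopological groups -/

section Ellis

/-- A pointwise continuous map from a separable space to `C(Y, ℝ)` has norm-separable range: every
`f x` factors through the metrizable quotient of `Y` defined by the countably many `f (d n)`. -/
theorem isSeparable_range_of_denseRange {X Y : Type*} [TopologicalSpace X]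
    [TopologicalSpace Y] [CompactSpace Y] (d : ℕ → X) (hd : DenseRange d) (f : X → C(Y, ℝ))
    (hf : ∀ y, Continuous fun x => f x y) : TopologicalSpace.IsSeparable (range f) := by
  let π : Y → (ℕ → ℝ) := fun y n => f (d n) y
  have hπ : Continuous π := by fun_prop
  let π' : C(Y, range π) := ⟨rangeFactorization π, hπ.rangeFactorization⟩
  have hq : IsQuotientMap π' :=
    IsQuotientMap.of_surjective_continuous rangeFactorization_surjective π'.continuous
  have : CompactSpace (range π) := isCompact_iff_compactSpace.1 (isCompact_range hπ)
  refine (TopologicalSpace.isSeparable_range (f := fun g : C(range π, ℝ) => g.comp π')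
    (ContinuousMap.continuous_precomp π')).mono ?_
  rintro _ ⟨x, rfl⟩
  refine ⟨hq.lift (f x) fun y y' h => ?_, hq.lift_comp _ _⟩
  have h' : π y = π y' := congrArg Subtype.val h
  exact congrFun (hd.equalizer (hf y) (hf y') (funext fun n => congrFun h' n)) x

/-- By separability and Baire's theorem some small closed ball has a preimage with interior points;
right translations carry that interior to any other point without changing distances. -/
theorem continuous_of_isSeparable_range {X Y : Type*} [Group X] [TopologicalSpace X]
    [SeparatelyContinuousMul X] [BaireSpace X] [TopologicalSpace Y] [CompactSpace Y]
    (f : X → C(Y, ℝ)) (hf : ∀ y, Continuous fun x => f x y)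
    (hdist : ∀ x x' g, dist (f (x * g)) (f (x' * g)) = dist (f x) (f x'))
    (hsep : TopologicalSpace.IsSeparable (range f)) : Continuous f := by
  obtain ⟨c, hc, hfc⟩ := hsep
  refine continuous_iff_continuousAt.2 fun x₀ => Metric.continuousAt_iff'.2 fun ε hε => ?_
  have hclosed : ∀ h : C(Y, ℝ), IsClosed {x | dist (f x) h ≤ ε / 3} := by
    intro h
    simp only [ContinuousMap.dist_le (by positivity : (0 : ℝ) ≤ ε / 3), ofPred_forall]
    exact isClosed_iInter fun y => isClosed_le ((hf y).dist continuous_const) continuous_const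
  have hcover : ⋃ h : c, {x | dist (f x) h ≤ ε / 3} = univ := by
    refine eq_univ_of_forall fun x => ?_
    obtain ⟨h, hh, hxh⟩ := Metric.mem_closure_iff.1 (hfc (mem_range_self x)) (ε / 3) (by positivity)
    exact mem_iUnion.2 ⟨⟨h, hh⟩, hxh.le⟩
  have := hc.to_subtype
  obtain ⟨⟨h, _⟩, x₁, hx₁⟩ := nonempty_interior_of_iUnion_of_closed
    (fun h : c => hclosed h) hcover
  have hcont : Continuous fun x : X => x * (x₀⁻¹ * x₁) :=
    SeparatelyContinuousMul.continuous_mul_const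
  have hmem : {x : X | dist (f x) h ≤ ε / 3} ∈ 𝓝 (x₀ * (x₀⁻¹ * x₁)) := by
    rw [mul_inv_cancel_left]; exact mem_interior_iff_mem_nhds.1 hx₁
  filter_upwards [hcont.continuousAt hmem] with x hx
  have h1 : dist (f (x * (x₀⁻¹ * x₁))) h ≤ ε / 3 := hx
  have h2 : dist (f (x₀ * (x₀⁻¹ * x₁))) h ≤ ε / 3 := by
    have := mem_of_mem_nhds hmem
    exact this
  rw [← hdist x x₀ (x₀⁻¹ * x₁)]
  linarith [dist_triangle_right (f (x * (x₀⁻¹ * x₁))) (f (x₀ * (x₀⁻¹ * x₁))) h]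

variable {G : Type*} [Group G] [TopologicalSpace G] [SeparatelyContinuousMul G] [CompactSpace G]
  [T2Space G]

/-- A closed submonoid is a subgroup: the compact semigroup `x * M` contains an idempotent, which can
only be `1`. -/
theorem inv_mem_of_isClosed (M : Submonoid G) (hM : IsClosed (M : Set G)) {x : G} (hx : x ∈ M) :
    x⁻¹ ∈ M := by
  obtain ⟨m, ⟨y, hy, rfl⟩, hm⟩ := exists_idempotent_in_compact_subsemigroup (M := G)
    (fun r => SeparatelyContinuousMul.continuous_mul_const) ((x * ·) '' M) ⟨x * 1, 1, M.one_mem, rfl⟩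
    (hM.isCompact.image SeparatelyContinuousMul.continuous_const_mul) (by
      rintro _ ⟨a, ha, rfl⟩ _ ⟨b, hb, rfl⟩
      exact ⟨a * (x * b), M.mul_mem ha (M.mul_mem hx hb), by simp only [mul_assoc]⟩)
  have : x * y = 1 := by simpa using hm
  rwa [inv_eq_of_mul_eq_one_right this]

theorem exists_isClosed_subgroup_denseRange (u : ℕ → G) : ∃ H : Subgroup G, IsClosed (H : Set G) ∧
    (∀ n, u n ∈ H) ∧ ∃ d : ℕ → H, DenseRange d := by
  let K : Submonoid G := MonoidHom.mrange (FreeMonoid.lift u)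
  have : Countable (FreeMonoid ℕ) := inferInstanceAs (Countable (List ℕ))
  have : Countable K := (FreeMonoid.lift u).mrangeRestrict_surjective.countable
  let M := K.topologicalClosure
  let H : Subgroup G := { M with inv_mem' := inv_mem_of_isClosed M isClosed_closure }
  have hKH : ∀ x ∈ K, x ∈ H := fun x hx => subset_closure hx
  refine ⟨H, isClosed_closure, fun n => hKH _ ⟨FreeMonoid.of n, by simp⟩, ?_⟩
  obtain ⟨v, hv⟩ := exists_surjective_nat K
  refine ⟨fun n => ⟨v n, hKH _ (v n).2⟩, fun x => ?_⟩
  rw [closure_subtype]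
  have : (Subtype.val '' range fun n => (⟨v n, hKH _ (v n).2⟩ : H)) = (K : Set G) := by
    ext z
    constructor
    · rintro ⟨_, ⟨n, rfl⟩, rfl⟩
      exact (v n).2
    · intro hz
      obtain ⟨n, hn⟩ := hv ⟨z, hz⟩
      exact ⟨_, ⟨n, rfl⟩, by simp [hn]⟩
  rw [this]
  exact x.2

/-- The left translates `h (x * ·)` of a continuous function depend norm-continuously on `x`. On a
separable closed subgroup this holds by Baire's theorem. Every sequence lies in such a subgroup, so
the set of translates is sequentially compact, hence separable, and Baire's theorem applies to `G`
itself. -/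
theorem continuous_comp_mulLeft (h : C(G, ℝ)) : Continuous fun x : G =>
    h.comp ⟨(x * ·), SeparatelyContinuousMul.continuous_const_mul⟩ := by
  set F : G → C(G, ℝ) := fun x => h.comp ⟨(x * ·), SeparatelyContinuousMul.continuous_const_mul⟩
  have hF : ∀ y, Continuous fun x => F x y := fun y =>
    h.continuous.comp SeparatelyContinuousMul.continuous_mul_const
  have hdist : ∀ x x' g, dist (F (x * g)) (F (x' * g)) = dist (F x) (F x') := by
    have key : ∀ x x' g, dist (F (x * g)) (F (x' * g)) ≤ dist (F x) (F x') := fun x x' g =>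
      (ContinuousMap.dist_le dist_nonneg).2 fun y => by
        simpa [F, mul_assoc] using (F x).dist_apply_le_dist (g := F x') (g * y)
    intro x x' g
    refine le_antisymm (key x x' g) ?_
    simpa using key (x * g) (x' * g) g⁻¹
  refine continuous_of_isSeparable_range F hF hdist (IsCompact.isSeparable ?_)
  refine IsSeqCompact.isCompact fun s hs => ?_
  choose u hu using hs
  obtain ⟨H, hH, huH, d, hd⟩ := exists_isClosed_subgroup_denseRange u
  have : CompactSpace H := isCompact_iff_compactSpace.1 hH.isCompact
  have : SeparatelyContinuousMul H :=
    ⟨(SeparatelyContinuousMul.continuous_const_mul.comp continuous_subtype_val).subtype_mk _,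
      (SeparatelyContinuousMul.continuous_mul_const.comp continuous_subtype_val).subtype_mk _⟩
  have hFH : Continuous fun x : H => F x := continuous_of_isSeparable_range (fun x : H => F x)
    (fun y => (hF y).comp continuous_subtype_val) (fun x x' g => hdist x x' g)
    (isSeparable_range_of_denseRange d hd _ fun y => (hF y).comp continuous_subtype_val)
  obtain ⟨_, ⟨x, rfl⟩, φ, hφ, hlim⟩ := (isCompact_range hFH).isSeqCompact
    (x := s) fun n => ⟨⟨u n, huH n⟩, hu n⟩
  exact ⟨_, ⟨x, rfl⟩, φ, hφ, hlim⟩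

/-- Ellis' theorem for compact groups: separate continuity of the multiplication suffices. -/
theorem isTopologicalGroup_of_compactSpace : IsTopologicalGroup G := by
  have hmul : ContinuousMul G := by
    refine ⟨continuous_iff_continuousAt.2 fun ⟨x, y⟩ s hs => ?_⟩
    obtain ⟨O, hOs, hO, hxO⟩ := mem_nhds_iff.1 hs
    obtain ⟨h, h0, h1, -⟩ := exists_continuous_zero_one_of_isClosed hO.isClosed_compl
      (isClosed_singleton (x := x * y)) (by simpa using hxO)
    have hc : Continuous fun p : G × G => h (p.1 * p.2) :=
      ((continuous_comp_mulLeft h).comp continuous_fst).eval continuous_snd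
    have : {p : G × G | h (p.1 * p.2) ≠ 0} ∈ 𝓝 (x, y) :=
      (isOpen_ne.preimage hc).mem_nhds (by simp [h1 rfl])
    refine mem_map.2 ?_
    filter_upwards [this] with p hp
    by_contra hps
    exact hp (h0 fun h => hps (hOs h))
  refine { hmul with continuous_inv := ?_ }
  refine continuous_iff_isClosed.2 fun C hC => ?_
  have : (Inv.inv ⁻¹' C : Set G) = Prod.fst '' ({p : G × G | p.1 * p.2 = 1} ∩ Prod.snd ⁻¹' C) := by
    ext x
    constructor
    · exact fun hx => ⟨(x, x⁻¹), ⟨by simp, hx⟩, rfl⟩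
    · rintro ⟨⟨a, b⟩, ⟨hab, hb⟩, rfl⟩
      have : a⁻¹ = b := inv_eq_of_mul_eq_one_right hab
      simpa [this] using hb
  rw [this]
  exact isClosedMap_fst_of_compactSpace _
    ((isClosed_eq continuous_mul continuous_const).inter (hC.preimage continuous_snd))

end Ellis

/-! ### Idempotents forming an `ω`-chain -/

section OmegaChain

/-- `c` enumerates the nonzero idempotents of the monoid `S` as a chain `1 = c 0 > c 1 > c 2 > ⋯`,
so that `c m * c n = c (max m n)`. -/
structure IsOmegaChain {S : Type*} [MonoidWithZero S] (c : ℕ → S) : Prop where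
  zero : c 0 = 1
  mul : ∀ m n, c m * c n = c (max m n)
  injective : Function.Injective c
  ne_zero : ∀ n, c n ≠ 0
  exists_eq : ∀ f : S, f * f = f → f ≠ 0 → ∃ n, f = c n

variable {S : Type*} [MonoidWithZero S] {c : ℕ → S}

theorem mul_mul_mul_cancel_middle {a b : S} (hba : b * a = 1) (x y : S) :
    a * x * b * (a * y * b) = a * (x * y) * b := by
  calc a * x * b * (a * y * b) = a * x * (b * a) * y * b := by simp only [mul_assoc]
    _ = a * (x * y) * b := by rw [hba]; simp only [mul_assoc, one_mul]

theorem mul_conj_mul {a b : S} (hba : b * a = 1) (x : S) : b * (a * x * b) * a = x := by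
  calc b * (a * x * b) * a = b * a * x * (b * a) := by simp only [mul_assoc]
    _ = x := by rw [hba, one_mul, mul_one]

theorem IsOmegaChain.strictMono (h : IsOmegaChain c) {f : ℕ → S} (hf : Function.Injective f)
    (hmul : ∀ m n, f m * f n = f (max m n)) {σ : ℕ → ℕ} (hσ : ∀ n, f n = c (σ n)) :
    StrictMono σ := by
  intro m n hmn
  have h1 : c (max (σ m) (σ n)) = c (σ n) := by
    rw [← h.mul, ← hσ, ← hσ, hmul, max_eq_right hmn.le]
  have h2 : σ m ≠ σ n := fun h' => hmn.ne (hf (by rw [hσ, hσ, h']))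
  have := h.injective h1
  omega

/-- If `b * a = 1`, then `x ↦ a * x * b` is an order isomorphism of the chain onto its part below
`a * b`. An `ω`-chain being rigid, it is the shift by the index of `a * b`. -/
theorem IsOmegaChain.conj (h : IsOmegaChain c) {a b : S} {k : ℕ} (hba : b * a = 1)
    (hab : a * b = c k) (n : ℕ) : a * c n * b = c (n + k) := by
  have hck : ∀ n, c k * c (n + k) = c (n + k) ∧ c (n + k) * c k = c (n + k) := fun n => by
    rw [h.mul, h.mul, max_eq_right (by omega), max_eq_left (by omega)]; exact ⟨rfl, rfl⟩
  have hback : ∀ n, a * (b * c (n + k) * a) * b = c (n + k) := fun n => by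
    calc a * (b * c (n + k) * a) * b = a * b * c (n + k) * (a * b) := by simp only [mul_assoc]
      _ = c (n + k) := by rw [hab, (hck n).1, (hck n).2]
  have hmulσ : ∀ m n, a * c m * b * (a * c n * b) = a * c (max m n) * b := fun m n => by
    rw [mul_mul_mul_cancel_middle hba, h.mul]
  have hmulτ : ∀ m n, b * c (m + k) * a * (b * c (n + k) * a) = b * c (max m n + k) * a := by
    intro m n
    calc b * c (m + k) * a * (b * c (n + k) * a)
        = b * (c (m + k) * (a * b)) * c (n + k) * a := by simp only [mul_assoc]
      _ = b * c (max m n + k) * a := by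
        rw [hab, (hck m).2, mul_assoc b, h.mul, max_add_add_right]
  have hσ : ∀ n, ∃ m, a * c n * b = c m := fun n => by
    refine h.exists_eq _ (by rw [hmulσ, max_self]) fun h0 => h.ne_zero n ?_
    rw [← mul_conj_mul hba (c n), h0, mul_zero, zero_mul]
  have hτ : ∀ n, ∃ m, b * c (n + k) * a = c m := fun n => by
    refine h.exists_eq _ (by rw [hmulτ, max_self]) fun h0 => h.ne_zero (n + k) ?_
    rw [← hback, h0, mul_zero, zero_mul]
  choose σ hσ using hσ
  choose τ hτ using hτ
  have hσm : StrictMono σ := h.strictMono (f := fun n => a * c n * b) (fun m n hmn => by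
    have := congrArg (fun x => b * x * a) hmn
    simp only [mul_conj_mul hba] at this
    exact h.injective this) hmulσ hσ
  have hτm : StrictMono τ := h.strictMono (f := fun n => b * c (n + k) * a) (fun m n hmn => by
    have := congrArg (fun x => a * x * b) hmn
    simp only [hback] at this
    have := h.injective this
    omega) hmulτ hτ
  have h0 : σ 0 = k := h.injective (by rw [← hσ, h.zero, mul_one, hab])
  have h1 : n + k ≤ σ n := by
    have := hσm.add_le_nat n 0
    simpa [h0] using this
  have h2 : σ (τ n) = n + k := h.injective (by rw [← hσ, ← hτ, hback])
  have h3 : σ n ≤ σ (τ n) := hσm.monotone hτm.le_apply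
  rw [hσ, le_antisymm (h3.trans h2.le) h1]

theorem IsOmegaChain.pow_mul_pow (h : IsOmegaChain c) {p q : S} (hpq : p * q = 1)
    (hqp : q * p = c 1) (n : ℕ) : q ^ n * p ^ n = c n := by
  induction n with
  | zero => simp [h.zero]
  | succ n ih => rw [pow_succ' q, pow_succ p, ← h.conj hpq hqp n, ← ih]; simp only [mul_assoc]

/-- Units commute with idempotents: this is `IsOmegaChain.conj` with shift zero. -/
theorem IsOmegaChain.commute (h : IsOmegaChain c) {a b : S} (hba : b * a = 1)
    (hab : a * b = 1) (n : ℕ) : a * c n = c n * a := by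
  have := h.conj (k := 0) hba (by rw [hab, h.zero]) n
  rw [Nat.add_zero] at this
  rw [← this, mul_assoc (a * c n), hba, mul_one]
  rw [this]

end OmegaChain

/-! ### Reilly's structure theorem -/

namespace ReillySemigroup

variable {S : Type*} [MonoidWithZero S] {G : Type*} [Group G] {θ : G →* G}

/-- The element `q ^ i * ψ g * p ^ j` of a monoid that stands for `(i, g, j)`. -/
def toMonoid (ψ : G →* S) (p q : S) (x : ReillySemigroup θ) : S :=
  q ^ x.left * ψ x.mid * p ^ x.right

theorem pow_mul_map {ψ : G →* S} {p : S} (hp : ∀ g, p * ψ g = ψ (θ g) * p) (n : ℕ) (g : G) :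
    p ^ n * ψ g = ψ (θ^[n] g) * p ^ n := by
  induction n generalizing g with
  | zero => simp
  | succ n ih => rw [pow_succ, mul_assoc, hp, ← mul_assoc, ih, mul_assoc, Function.iterate_succ_apply]

theorem map_mul_pow {ψ : G →* S} {q : S} (hq : ∀ g, ψ g * q = q * ψ (θ g)) (n : ℕ) (g : G) :
    ψ g * q ^ n = q ^ n * ψ (θ^[n] g) := by
  induction n generalizing g with
  | zero => simp
  | succ n ih => rw [pow_succ', ← mul_assoc, hq, mul_assoc, ih, mul_assoc,
      Function.iterate_succ_apply]

theorem toMonoid_mul {ψ : G →* S} {p q : S} (hpq : p * q = 1)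
    (hp : ∀ g, p * ψ g = ψ (θ g) * p) (hq : ∀ g, ψ g * q = q * ψ (θ g))
    (x y : ReillySemigroup θ) :
    toMonoid ψ p q (x * y) = toMonoid ψ p q x * toMonoid ψ p q y := by
  obtain ⟨i, s, j⟩ := x
  obtain ⟨m, t, n⟩ := y
  simp only [toMonoid, mul_def]
  rcases le_total j m with hjm | hjm
  · obtain ⟨d, rfl⟩ := Nat.exists_eq_add_of_le hjm
    rw [min_eq_left hjm, show i + (j + d) - j = i + d by omega, show j + d - j = d by omega,
      Nat.sub_self, show j + n - j = n by omega, Function.iterate_zero_apply, map_mul]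
    calc q ^ (i + d) * (ψ (θ^[d] s) * ψ t) * p ^ n
        = q ^ i * (q ^ d * ψ (θ^[d] s)) * ψ t * p ^ n := by rw [pow_add]; simp only [mul_assoc]
      _ = q ^ i * ψ s * (p ^ j * q ^ j) * q ^ d * ψ t * p ^ n := by
        rw [← map_mul_pow hq, pow_mul_pow_eq_one _ hpq, mul_one]; simp only [mul_assoc]
      _ = q ^ i * ψ s * p ^ j * (q ^ (j + d) * ψ t * p ^ n) := by
        rw [pow_add]; simp only [mul_assoc]
  · obtain ⟨d, rfl⟩ := Nat.exists_eq_add_of_le hjm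
    rw [min_eq_right hjm, show i + m - m = i by omega, show m + d - m = d by omega,
      Nat.sub_self, show m + d + n - m = d + n by omega, Function.iterate_zero_apply, map_mul]
    calc q ^ i * (ψ s * ψ (θ^[d] t)) * p ^ (d + n)
        = q ^ i * ψ s * (ψ (θ^[d] t) * p ^ d) * p ^ n := by rw [pow_add]; simp only [mul_assoc]
      _ = q ^ i * ψ s * p ^ d * (p ^ m * q ^ m) * ψ t * p ^ n := by
        rw [← pow_mul_map hp, pow_mul_pow_eq_one _ hpq, mul_one]; simp only [mul_assoc]
      _ = q ^ i * ψ s * p ^ (m + d) * (q ^ m * ψ t * p ^ n) := by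
        rw [add_comm m d, pow_add]; simp only [mul_assoc]

end ReillySemigroup

/-- Reilly's theorem in a monoid with zero, given `p` and `q` that generate a bicyclic submonoid
through all nonzero idempotents. The group is the maximal subgroup at an arbitrary `e = c k`; it is
moved to the group of units by `g ↦ p ^ k * g * q ^ k`. The coordinates and `θ` are given by
two-sided translations, so that they are continuous when these are. -/
theorem exists_reilly_equiv_of_monoid {S : Type*} [MonoidWithZero S] {c : ℕ → S}
    (hc : IsOmegaChain c) (hinv : ∀ x : S, ∃ y, x * y * x = x ∧ y * x * y = y)
    {p q : S} (hpq : p * q = 1) (hqp : q * p = c 1)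
    {e : S} (he : IsIdempotentElem e) (he0 : e ≠ 0) :
    ∃ (θ : MaximalSubgroup he →* MaximalSubgroup he) (Φ : WithZero (ReillySemigroup θ) ≃* S),
      (∃ a b : S, ∀ g, (θ g).1 = a * g.1 * b) ∧
      ∀ i j, ∃ a b : S, ∀ g, Φ (⟨i, g, j⟩ : ReillySemigroup θ) = a * g.1 * b := by
  obtain ⟨k, hek⟩ := hc.exists_eq e he he0
  have hpow := fun n => pow_mul_pow_eq_one n hpq
  have hpow' := hc.pow_mul_pow hpq hqp
  have he' : q ^ k * p ^ k = e := by rw [hpow', hek]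
  have heq : e * q ^ k = q ^ k := by rw [← he', mul_assoc, hpow, mul_one]
  have hpe : p ^ k * e = p ^ k := by rw [← he', ← mul_assoc, hpow, one_mul]
  have heG : ∀ g : MaximalSubgroup he, e * g.1 = g.1 ∧ g.1 * e = g.1 := fun g =>
    ((greenH_idem_iff he g.1).1 g.2).1
  -- `ψ` identifies the maximal subgroup at `e` with the group of units.
  let ψ : MaximalSubgroup he →* S :=
    { toFun := fun g => p ^ k * g.1 * q ^ k
      map_one' := by
        change p ^ k * e * q ^ k = 1
        rw [hpe, hpow]
      map_mul' := fun g h => by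
        change p ^ k * (g.1 * h.1) * q ^ k = _
        have hh : h.1 = q ^ k * (p ^ k * h.1) := by rw [← mul_assoc, he', (heG h).1]
        conv_lhs => rw [hh]
        simp only [mul_assoc] }
  have hψ : ∀ g, ψ g = p ^ k * g.1 * q ^ k := fun g => rfl
  have hψψ : ∀ g, ψ g * ψ g⁻¹ = 1 := fun g => by rw [← map_mul, mul_inv_cancel, map_one]
  have hψψ' : ∀ g, ψ g⁻¹ * ψ g = 1 := fun g => by rw [← map_mul, inv_mul_cancel, map_one]
  have hback : ∀ g, q ^ k * ψ g * p ^ k = g.1 := fun g => by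
    calc q ^ k * (p ^ k * g.1 * q ^ k) * p ^ k
        = q ^ k * p ^ k * g.1 * (q ^ k * p ^ k) := by simp only [mul_assoc]
      _ = g.1 := by rw [he', (heG g).1, (heG g).2]
  have hmem : ∀ {w w' : S}, w * w' = 1 → w' * w = 1 → GreenH (q ^ k * w * p ^ k) e := by
    intro w w' h h'
    refine (greenH_idem_iff he _).2 ⟨⟨?_, ?_⟩, ⟨q ^ k * w' * p ^ k, ?_⟩, ⟨q ^ k * w' * p ^ k, ?_⟩⟩
    · rw [mul_assoc, ← mul_assoc, heq]
    · rw [mul_assoc, ← he', ← mul_assoc (p ^ k), hpow, one_mul]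
    · rw [mul_mul_mul_cancel_middle (hpow k), h, mul_one, he']
    · rw [mul_mul_mul_cancel_middle (hpow k), h', mul_one, he']
  have hψmk : ∀ w (hw : GreenH (q ^ k * w * p ^ k) e), ψ ⟨q ^ k * w * p ^ k, hw⟩ = w :=
    fun w hw => mul_conj_mul (hpow k) w
  have hcomm : ∀ g, ψ g * c 1 = c 1 * ψ g := fun g => hc.commute (hψψ' g) (hψψ g) 1
  have hpc : p * c 1 = p := by rw [← hqp, ← mul_assoc, hpq, one_mul]
  have hcq : c 1 * q = q := by rw [← hqp, mul_assoc, hpq, mul_one]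
  have hθmul : ∀ g h, p * ψ g * q * (p * ψ h * q) = p * ψ (g * h) * q := fun g h => by
    calc p * ψ g * q * (p * ψ h * q) = p * (ψ g * (q * p)) * ψ h * q := by simp only [mul_assoc]
      _ = p * c 1 * (ψ g * ψ h) * q := by rw [hqp, hcomm]; simp only [mul_assoc]
      _ = p * ψ (g * h) * q := by rw [hpc, map_mul]
  have hθ1 : p * ψ 1 * q = 1 := by rw [map_one, mul_one, hpq]
  let θ : MaximalSubgroup he →* MaximalSubgroup he :=
    { toFun := fun g => ⟨q ^ k * (p * ψ g * q) * p ^ k, hmem (w' := p * ψ g⁻¹ * q)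
        (by rw [hθmul, mul_inv_cancel, hθ1]) (by rw [hθmul, inv_mul_cancel, hθ1])⟩
      map_one' := Subtype.ext (by
        change q ^ k * (p * ψ 1 * q) * p ^ k = e
        rw [hθ1, mul_one, he'])
      map_mul' := fun g h => Subtype.ext (by
        change q ^ k * (p * ψ (g * h) * q) * p ^ k =
          q ^ k * (p * ψ g * q) * p ^ k * (q ^ k * (p * ψ h * q) * p ^ k)
        rw [mul_mul_mul_cancel_middle (hpow k), hθmul]) }
  have hψθ : ∀ g, ψ (θ g) = p * ψ g * q := fun g => hψmk _ _
  have hp : ∀ g, p * ψ g = ψ (θ g) * p := fun g => by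
    rw [hψθ, mul_assoc (p * ψ g), hqp, mul_assoc, hcomm, ← mul_assoc, hpc]
  have hq : ∀ g, ψ g * q = q * ψ (θ g) := fun g => by
    rw [hψθ, ← mul_assoc, ← mul_assoc, hqp, ← hcomm, mul_assoc, hcq]
  let F : ReillySemigroup θ → S := ReillySemigroup.toMonoid ψ p q
  have hF : ∀ x, F x = q ^ x.left * ψ x.mid * p ^ x.right := fun x => rfl
  have hFback : ∀ x, p ^ x.left * F x * q ^ x.right = ψ x.mid := fun x => by
    rw [hF]
    calc p ^ x.left * (q ^ x.left * ψ x.mid * p ^ x.right) * q ^ x.right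
        = p ^ x.left * q ^ x.left * ψ x.mid * (p ^ x.right * q ^ x.right) := by
          simp only [mul_assoc]
      _ = ψ x.mid := by rw [hpow, hpow, one_mul, mul_one]
  have hF0 : ∀ x, F x ≠ 0 := fun x h0 => by
    have h1 : (1 : S) = 0 := by rw [← hψψ x.mid, ← hFback x, h0, mul_zero, zero_mul, zero_mul]
    exact hc.ne_zero 0 (hc.zero.trans h1)
  -- The indices of `F x` are read off from `F x * F' x` and `F' x * F x`, where `F' x` is the
  -- inverse of `F x`.
  let F' : ReillySemigroup θ → S := fun x => q ^ x.right * ψ x.mid⁻¹ * p ^ x.left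
  have hFF' : ∀ x, F x * F' x = c x.left := fun x => by
    calc q ^ x.left * ψ x.mid * p ^ x.right * (q ^ x.right * ψ x.mid⁻¹ * p ^ x.left)
        = q ^ x.left * (ψ x.mid * (p ^ x.right * q ^ x.right) * ψ x.mid⁻¹) * p ^ x.left := by
          simp only [mul_assoc]
      _ = c x.left := by rw [hpow, mul_one, hψψ, mul_one, hpow']
  have hF'F : ∀ x, F' x * F x = c x.right := fun x => by
    calc q ^ x.right * ψ x.mid⁻¹ * p ^ x.left * (q ^ x.left * ψ x.mid * p ^ x.right)
        = q ^ x.right * (ψ x.mid⁻¹ * (p ^ x.left * q ^ x.left) * ψ x.mid) * p ^ x.right := by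
          simp only [mul_assoc]
      _ = c x.right := by rw [hpow, mul_one, hψψ', mul_one, hpow']
  have hcF : ∀ x, c x.left * F x = F x := fun x => by
    rw [hF, ← hpow', mul_assoc (q ^ x.left) (ψ x.mid), ← mul_assoc, mul_assoc (q ^ x.left), hpow,
      mul_one]
  have hFc : ∀ x, F x * c x.right = F x := fun x => by
    rw [hF, ← hpow', mul_assoc, ← mul_assoc (p ^ x.right), hpow, one_mul]
  have hle : ∀ x y, F x = F y → x.left ≤ y.left ∧ x.right ≤ y.right := fun x y hxy => by
    have h1 : c (max x.left y.left) = c y.left := by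
      rw [← hc.mul, ← hFF' y, ← mul_assoc, ← hxy, hcF]
    have h2 : c (max y.right x.right) = c y.right := by
      rw [← hc.mul, ← hF'F y, mul_assoc, ← hxy, hFc]
    have := hc.injective h1
    have := hc.injective h2
    omega
  have hFinj : Function.Injective F := fun x y hxy => by
    have h1 := hle x y hxy
    have h2 := hle y x hxy.symm
    have hl : x.left = y.left := le_antisymm h1.1 h2.1
    have hr : x.right = y.right := le_antisymm h1.2 h2.2
    refine ReillySemigroup.ext hl (Subtype.ext ?_) hr
    rw [← hback, ← hback y.mid, ← hFback, ← hFback, hxy, hl, hr]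
  have hFsurj : ∀ x : S, x ≠ 0 → ∃ r, F r = x := fun x hx => by
    obtain ⟨y, hxy, hyx⟩ := hinv x
    obtain ⟨i, hi⟩ := hc.exists_eq (x * y) (by rw [← mul_assoc, hxy])
      (fun h0 => hx (by rw [← hxy, h0, zero_mul]))
    obtain ⟨j, hj⟩ := hc.exists_eq (y * x) (by rw [← mul_assoc, hyx])
      (fun h0 => hx (by rw [← hxy, mul_assoc, h0, mul_zero]))
    have h1 : p ^ i * x * q ^ j * (p ^ j * y * q ^ i) = 1 := by
      calc p ^ i * x * q ^ j * (p ^ j * y * q ^ i)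
          = p ^ i * (x * (q ^ j * p ^ j) * y) * q ^ i := by simp only [mul_assoc]
        _ = p ^ i * (q ^ i * p ^ i) * q ^ i := by
          rw [hpow', hpow', ← hj, ← mul_assoc x, hxy, hi]
        _ = p ^ i * q ^ i * (p ^ i * q ^ i) := by simp only [mul_assoc]
        _ = 1 := by rw [hpow, mul_one]
    have h2 : p ^ j * y * q ^ i * (p ^ i * x * q ^ j) = 1 := by
      calc p ^ j * y * q ^ i * (p ^ i * x * q ^ j)
          = p ^ j * (y * (q ^ i * p ^ i) * x) * q ^ j := by simp only [mul_assoc]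
        _ = p ^ j * (q ^ j * p ^ j) * q ^ j := by
          rw [hpow', hpow', ← hi, ← mul_assoc y, hyx, hj]
        _ = p ^ j * q ^ j * (p ^ j * q ^ j) := by simp only [mul_assoc]
        _ = 1 := by rw [hpow, mul_one]
    refine ⟨⟨i, ⟨q ^ k * (p ^ i * x * q ^ j) * p ^ k, hmem h1 h2⟩, j⟩, ?_⟩
    rw [hF, hψmk]
    calc q ^ i * (p ^ i * x * q ^ j) * p ^ j = q ^ i * p ^ i * x * (q ^ j * p ^ j) := by
          simp only [mul_assoc]
      _ = x := by rw [hpow', hpow', ← hi, ← hj, hxy, ← mul_assoc, hxy]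
  let Φ₀ : WithZero (ReillySemigroup θ) → S := WithZero.recZeroCoe 0 F
  have hΦ : Function.Bijective Φ₀ := by
    constructor
    · intro x y hxy
      induction x using WithZero.recZeroCoe with
      | zero =>
        induction y using WithZero.recZeroCoe with
        | zero => rfl
        | coe y => exact absurd hxy.symm (hF0 y)
      | coe x =>
        induction y using WithZero.recZeroCoe with
        | zero => exact absurd hxy (hF0 x)
        | coe y => exact congrArg _ (hFinj hxy)
    · intro x
      by_cases hx : x = 0
      · exact ⟨0, hx.symm⟩
      · obtain ⟨r, hr⟩ := hFsurj x hx
        exact ⟨r, hr⟩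
  refine ⟨θ, { Equiv.ofBijective Φ₀ hΦ with map_mul' := ?_ },
    ⟨q ^ k * p * p ^ k, q ^ k * q * p ^ k, fun g => ?_⟩,
    fun i j => ⟨q ^ i * p ^ k, q ^ k * p ^ j, fun g => ?_⟩⟩
  · intro x y
    change Φ₀ (x * y) = Φ₀ x * Φ₀ y
    induction x using WithZero.recZeroCoe with
    | zero => rw [zero_mul]; exact (zero_mul _).symm
    | coe x =>
      induction y using WithZero.recZeroCoe with
      | zero => rw [mul_zero]; exact (mul_zero _).symm
      | coe y =>
        rw [← WithZero.coe_mul]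
        exact ReillySemigroup.toMonoid_mul hpq hp hq x y
  · change q ^ k * (p * ψ g * q) * p ^ k = _
    rw [hψ]; simp only [mul_assoc]
  · change q ^ i * ψ g * p ^ j = _
    rw [hψ]; simp only [mul_assoc]

namespace IsZeroBisimpleInverseOmegaSemigroup

/-- Reilly's theorem: the largest idempotent is an identity, and an element `q` that is `𝓛`-related
to it and `𝓡`-related to the next idempotent supplies the bicyclic submonoid. -/
theorem exists_reilly_equiv {S : Type*} [SemigroupWithZero S]
    (hS : IsZeroBisimpleInverseOmegaSemigroup S) {e : S} (he : IsIdempotentElem e) (he0 : e ≠ 0) :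
    ∃ (θ : MaximalSubgroup he →* MaximalSubgroup he) (Φ : WithZero (ReillySemigroup θ) ≃* S),
      (∃ a b : S, ∀ g, (θ g).1 = a * g.1 * b) ∧
      ∀ i j, ∃ a b : S, ∀ g, Φ (⟨i, g, j⟩ : ReillySemigroup θ) = a * g.1 * b := by
  obtain ⟨c, hc⟩ := hS.omega_chain
  have hinv : ∀ x : S, ∃ y, x * y * x = x ∧ y * x * y = y := fun x => (hS.inverse x).exists
  have hex : ∀ f : S, f * f = f → f ≠ 0 → ∃ n, f = (c n).1 := fun f hf hf0 =>
    ⟨c.symm ⟨f, hf, hf0⟩, by rw [c.apply_symm_apply]⟩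
  have h0 : ∀ f : S, f * f = f → (c 0).1 * f = f ∧ f * (c 0).1 = f := fun f hf => by
    by_cases hf0 : f = 0
    · rw [hf0, mul_zero, zero_mul]; exact ⟨rfl, rfl⟩
    · obtain ⟨n, rfl⟩ := hex f hf hf0
      exact ((hc 0 n).1 n.zero_le).symm
  have hone : ∀ x : S, (c 0).1 * x = x := fun x => by
    obtain ⟨y, hxy, hyx⟩ := hinv x
    have h := (h0 (x * y) (by rw [← mul_assoc, hxy])).1
    rw [← hxy, ← mul_assoc, h]
  have hone' : ∀ x : S, x * (c 0).1 = x := fun x => by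
    obtain ⟨y, hxy, hyx⟩ := hinv x
    have h := (h0 (y * x) (by rw [← mul_assoc, hyx])).2
    rw [← hxy, mul_assoc x, mul_assoc x, h]
  obtain ⟨q, hl, hr⟩ := (hS.greenD_iff (c 0).1 (c 1).1).2
    ⟨fun h => absurd h (c 0).2.2, fun h => absurd h (c 1).2.2⟩
  have hsq : ∃ s, s * q = (c 0).1 := by
    have : (c 0).1 ∈ principalLeftIdeal q := hl ▸ Or.inl rfl
    rcases this with h | ⟨s, h⟩
    · exact ⟨(c 0).1, by rw [← h]; exact (c 0).2.1⟩
    · exact ⟨s, h.symm⟩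
  have hqt : ∃ t, q * t = (c 1).1 := by
    have : (c 1).1 ∈ principalRightIdeal q := hr ▸ Or.inl rfl
    rcases this with h | ⟨t, h⟩
    · exact ⟨(c 0).1, by rw [hone', h]⟩
    · exact ⟨t, h.symm⟩
  have hcq : (c 1).1 * q = q := by
    have : q ∈ principalRightIdeal (c 1).1 := hr ▸ Or.inl rfl
    rcases this with h | ⟨t, h⟩
    · rw [h]; exact (c 1).2.1
    · rw [h, ← mul_assoc]; exact congrArg (· * t) (c 1).2.1
  obtain ⟨s, hs⟩ := hsq
  obtain ⟨t, ht⟩ := hqt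
  have htq : t * q = (c 0).1 := by
    calc t * q = s * q * (t * q) := by rw [hs, hone]
      _ = s * (q * t * q) := by simp only [mul_assoc]
      _ = (c 0).1 := by rw [ht, hcq, hs]
  let inst : MonoidWithZero S :=
    { ‹SemigroupWithZero S› with
      one := (c 0).1
      one_mul := hone
      mul_one := hone' }
  have hchain : @IsOmegaChain S inst fun n => (c n).1 :=
    { zero := rfl
      mul := fun m n => by
        rcases le_total m n with h | h
        · rw [max_eq_right h]; exact ((hc m n).1 h).2
        · rw [max_eq_left h]; exact ((hc n m).1 h).1
      injective := Subtype.val_injective.comp c.injective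
      ne_zero := fun n => (c n).2.2
      exists_eq := hex }
  exact @exists_reilly_equiv_of_monoid S inst _ hchain hinv t q htq ht e he he0

end IsZeroBisimpleInverseOmegaSemigroup

/-! ### Spaces made of one point and open compact blocks -/

/-- `X` is the disjoint union of the point `z` and of open blocks, the `i`-th of which is the image
of the injective continuous map `e i : G → X`. For compact `G` and Hausdorff `X` each `e i` is then
a homeomorphism onto a clopen block, so that only the neighbourhoods of `z` remain to be known. -/
structure IsBlockDecomposition {ι G X : Type*} [TopologicalSpace G] [TopologicalSpace X] (z : X)
    (e : ι → G → X) : Prop where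
  continuous : ∀ i, Continuous (e i)
  inj : ∀ {i j g h}, e i g = e j h → i = j ∧ g = h
  ne : ∀ i g, e i g ≠ z
  exists_eq : ∀ x, x ≠ z → ∃ i g, e i g = x
  isOpen_range : ∀ i, IsOpen (range (e i))

namespace IsBlockDecomposition

variable {ι G X : Type*} [TopologicalSpace G] [TopologicalSpace X]
  {z : X} {e : ι → G → X}

/-- The neighbourhoods of `z`, together with the topology of `G`, determine the topology of `X`. -/
theorem isOpen_iff [CompactSpace G] [T2Space X] (h : IsBlockDecomposition z e) {W : Set X} :
    IsOpen W ↔ (∀ i, IsOpen (e i ⁻¹' W)) ∧ (z ∈ W → W ∈ 𝓝 z) := by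
  refine ⟨fun hW => ⟨fun i => hW.preimage (h.continuous i), hW.mem_nhds⟩, fun ⟨hW, hz⟩ => ?_⟩
  refine isOpen_iff_mem_nhds.2 fun x hx => ?_
  by_cases hxz : x = z
  · subst hxz; exact hz hx
  · obtain ⟨i, g, rfl⟩ := h.exists_eq x hxz
    have he : IsOpenEmbedding (e i) :=
      ⟨((h.continuous i).isClosedEmbedding fun _ _ hgh => (h.inj hgh).2).isEmbedding,
        h.isOpen_range i⟩
    exact mem_of_superset ((he.isOpenMap _ (hW i)).mem_nhds ⟨g, hx, rfl⟩) (image_preimage_subset _ _)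

theorem biUnion_range_compl_mem_nhds [CompactSpace G] [T2Space X] (h : IsBlockDecomposition z e)
    {s : Set ι} (hs : s.Finite) :
    (⋃ i ∈ s, range (e i))ᶜ ∈ 𝓝 z :=
  (hs.isClosed_biUnion fun i _ => (isCompact_range (h.continuous i)).isClosed).isOpen_compl.mem_nhds
    (by simp [h.ne])

/-- A compact set lies in any neighbourhood of `z`, up to finitely many blocks: what it has outside
of the neighbourhood is compact and covered by the blocks, which are open and disjoint. -/
theorem finite_not_subset (h : IsBlockDecomposition z e) {U W : Set X} (hU : IsCompact U)
    (hW : W ∈ 𝓝 z) : {i | ¬ e i ⁻¹' U ⊆ e i ⁻¹' W}.Finite := by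
  obtain ⟨t, ht⟩ := (hU.diff (isOpen_interior (s := W))).elim_finite_subcover (fun i => range (e i))
    h.isOpen_range (by
      rintro x ⟨-, hx⟩
      obtain ⟨i, g, rfl⟩ := h.exists_eq x fun hxz => hx (hxz ▸ mem_interior_iff_mem_nhds.2 hW)
      exact mem_iUnion.2 ⟨i, g, rfl⟩)
  refine t.finite_toSet.subset fun i hi => ?_
  obtain ⟨g, hgU, hgW⟩ := not_subset.1 hi
  obtain ⟨j, hj, g', hg'⟩ := mem_iUnion₂.1 (ht ⟨hgU, fun hg => hgW (interior_subset (s := W) hg)⟩)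
  exact (h.inj hg').1 ▸ hj

end IsBlockDecomposition

/-! ### The neighbourhoods of zero -/

/-- The grid `ℕ × ℕ` stays connected when a finite square at the origin is removed: a function on it
with finitely many jumps between neighbours is constant off such a square. -/
theorem exists_eq_of_finite_ne {α : Type*} (V : ℕ × ℕ → α)
    (h₁ : {p : ℕ × ℕ | V (p.1 + 1, p.2) ≠ V p}.Finite)
    (h₂ : {p : ℕ × ℕ | V (p.1, p.2 + 1) ≠ V p}.Finite) :
    ∃ a N, ∀ p : ℕ × ℕ, N ≤ p.1 ∨ N ≤ p.2 → V p = a := by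
  obtain ⟨⟨N₁, N₂⟩, hN⟩ := (h₁.union h₂).bddAbove
  set N := max N₁ N₂ + 1
  have hstep : ∀ i j, N ≤ i ∨ N ≤ j → V (i + 1, j) = V (i, j) ∧ V (i, j + 1) = V (i, j) := by
    intro i j hij
    by_contra hcon
    have : (i, j) ∈ {p : ℕ × ℕ | V (p.1 + 1, p.2) ≠ V p} ∪ {p | V (p.1, p.2 + 1) ≠ V p} := by
      by_contra h
      simp only [mem_union, mem_ofPred_eq, not_or, not_not] at h
      exact hcon h
    have := hN this
    simp only [Prod.mk_le_mk] at this
    omega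
  have hrow : ∀ i j, N ≤ j → V (i, j) = V (0, j) := fun i j hj => by
    induction i with
    | zero => rfl
    | succ i ih => rw [(hstep i j (.inr hj)).1, ih]
  have hcol : ∀ i j, N ≤ i → V (i, j) = V (i, 0) := fun i j hi => by
    induction j with
    | zero => rfl
    | succ j ih => rw [(hstep i j (.inl hi)).2, ih]
  have hdiag : ∀ i j, N ≤ i → N ≤ j → V (i, j) = V (N, N) := fun i j hi hj => by
    rw [hcol i j hi, ← hcol i N hi, hrow i N le_rfl, ← hrow N N le_rfl]
  refine ⟨V (N, N), N, fun ⟨i, j⟩ hij => ?_⟩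
  rcases hij with hi | hj
  · rw [hcol i j hi, ← hcol i N hi, hdiag i N hi le_rfl]
  · rw [hrow i j hj, ← hrow N j hj, hdiag N j le_rfl hj]

namespace ReillySemigroup

section Mul

variable {G : Type*} [Group G] {θ : G →* G}

theorem idem_mul_eq_iff {i m n : ℕ} {g : G} :
    (⟨i, 1, i⟩ * ⟨m, g, n⟩ : ReillySemigroup θ) = ⟨m, g, n⟩ ↔ i ≤ m := by
  rw [mul_def]
  constructor
  · intro h
    have := congrArg left h
    simp only at this
    omega
  · intro h
    simp [min_eq_left h]

theorem mul_idem_eq_iff {j m n : ℕ} {g : G} :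
    (⟨m, g, n⟩ * ⟨j, 1, j⟩ : ReillySemigroup θ) = ⟨m, g, n⟩ ↔ j ≤ n := by
  rw [mul_def]
  constructor
  · intro h
    have := congrArg right h
    simp only at this
    omega
  · intro h
    simp [min_eq_right h]

theorem unit_mul (h : G) {g : G} {j : ℕ} :
    (⟨0, h, 0⟩ * ⟨0, g, j⟩ : ReillySemigroup θ) = ⟨0, h * g, j⟩ := by
  simp [mul_def]

theorem raise_mul {i j : ℕ} {g : G} :
    (⟨1, 1, 0⟩ * ⟨i, g, j⟩ : ReillySemigroup θ) = ⟨i + 1, g, j⟩ := by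
  simp [mul_def, add_comm]

theorem lower_mul {i j : ℕ} {g : G} :
    (⟨0, 1, 1⟩ * ⟨i + 1, g, j⟩ : ReillySemigroup θ) = ⟨i, g, j⟩ := by
  simp [mul_def]

theorem mul_raise {i j : ℕ} {g : G} :
    (⟨i, g, j⟩ * ⟨0, 1, 1⟩ : ReillySemigroup θ) = ⟨i, g, j + 1⟩ := by
  simp [mul_def]

theorem mul_lower {i j : ℕ} {g : G} :
    (⟨i, g, j + 1⟩ * ⟨1, 1, 0⟩ : ReillySemigroup θ) = ⟨i, g, j⟩ := by
  simp [mul_def]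

end Mul

variable {S : Type*} [SemigroupWithZero S] [TopologicalSpace S] [T2Space S]
  [SeparatelyContinuousMul S] {G : Type*} [Group G] [TopologicalSpace G] [CompactSpace G]
  {θ : G →* G}

/-- The `𝓗`-classes `G_{i,j}` are open: those with indices at most `(i, j)` make up the open set of
all `x` with `(i + 1, 1, i + 1) * x ≠ x` and `x * (j + 1, 1, j + 1) ≠ x`, and each of them is
compact, hence closed. -/
theorem isBlockDecomposition (Φ : WithZero (ReillySemigroup θ) ≃* S)
    (hΦ : ∀ i j, Continuous fun g => Φ (⟨i, g, j⟩ : ReillySemigroup θ)) :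
    IsBlockDecomposition (0 : S)
      fun (p : ℕ × ℕ) g => Φ (⟨p.1, g, p.2⟩ : ReillySemigroup θ) := by
  have hinj : ∀ {p q : ℕ × ℕ} {g h : G}, Φ (⟨p.1, g, p.2⟩ : ReillySemigroup θ) =
      Φ (⟨q.1, h, q.2⟩ : ReillySemigroup θ) → p = q ∧ g = h := fun {p q g h} hgh => by
    have := WithZero.coe_injective (Φ.injective hgh)
    simp only [mk.injEq] at this
    exact ⟨Prod.ext this.1 this.2.2, this.2.1⟩
  have hex : ∀ x : S, x ≠ 0 →
      ∃ (p : ℕ × ℕ) (g : G), Φ (⟨p.1, g, p.2⟩ : ReillySemigroup θ) = x := fun x hx => by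
    obtain ⟨y, rfl⟩ := Φ.surjective x
    induction y using WithZero.recZeroCoe with
    | zero => exact absurd (map_zero Φ) hx
    | coe y => exact ⟨(y.left, y.right), y.mid, rfl⟩
  refine ⟨fun p => hΦ p.1 p.2, hinj, fun p g h => ?_, hex, fun p => ?_⟩
  · exact WithZero.coe_ne_zero (Φ.injective (h.trans (map_zero Φ).symm))
  · let f : ℕ → S := fun i => Φ (⟨i, 1, i⟩ : ReillySemigroup θ)
    have hopen : IsOpen ({x | f (p.1 + 1) * x ≠ x} ∩ {x | x * f (p.2 + 1) ≠ x}) :=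
      (isOpen_ne_fun SeparatelyContinuousMul.continuous_const_mul continuous_id).inter
        (isOpen_ne_fun SeparatelyContinuousMul.continuous_mul_const continuous_id)
    have hclosed : IsClosed (⋃ q ∈ (Finset.Iic p).erase p,
        range fun g => Φ (⟨q.1, g, q.2⟩ : ReillySemigroup θ)) :=
      Set.Finite.isClosed_biUnion (Finset.finite_toSet _)
        fun q _ => (isCompact_range (hΦ q.1 q.2)).isClosed
    convert hopen.sdiff hclosed using 1
    have hmem : ∀ (q : ℕ × ℕ) (g : G), Φ (⟨q.1, g, q.2⟩ : ReillySemigroup θ) ∈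
        {x | f (p.1 + 1) * x ≠ x} ∩ {x | x * f (p.2 + 1) ≠ x} ↔ q ≤ p := by
      intro q g
      simp only [f, mem_inter_iff, mem_ofPred_eq, ne_eq, ← map_mul, Φ.injective.eq_iff,
        ← WithZero.coe_mul, WithZero.coe_inj, idem_mul_eq_iff, mul_idem_eq_iff, Prod.le_def]
      omega
    ext x
    constructor
    · rintro ⟨g, rfl⟩
      refine ⟨(hmem p g).2 le_rfl, fun h => ?_⟩
      obtain ⟨q, hq, g', hg'⟩ := mem_iUnion₂.1 h
      exact (Finset.mem_erase.1 hq).1 (hinj hg').1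
    · rintro ⟨hx, hx'⟩
      have hx0 : x ≠ 0 := by
        rintro rfl
        exact hx.1 (mul_zero _)
      obtain ⟨q, g, rfl⟩ := hex x hx0
      by_cases hqp : q = p
      · subst hqp; exact ⟨g, rfl⟩
      · exact (hx' (mem_iUnion₂.2 ⟨q, Finset.mem_erase.2
          ⟨hqp, Finset.mem_Iic.2 ((hmem q g).1 hx)⟩, g, rfl⟩)).elim

/-- Either `0` is isolated or each of its neighbourhoods contains almost all `G_{i,j}`. Since
translations are continuous at `0`, the traces of a compact neighbourhood of `0` on neighbouring
`G_{i,j}` coincide up to finitely many exceptions, so that almost all of them are equal. -/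
theorem singleton_zero_mem_nhds_or [LocallyCompactSpace S] (Φ : WithZero (ReillySemigroup θ) ≃* S)
    (hΦ : ∀ i j, Continuous fun g => Φ (⟨i, g, j⟩ : ReillySemigroup θ)) :
    {0} ∈ 𝓝 (0 : S) ∨ ∀ W ∈ 𝓝 (0 : S),
      {p : ℕ × ℕ | (fun g => Φ (⟨p.1, g, p.2⟩ : ReillySemigroup θ)) ⁻¹' W ≠ univ}.Finite := by
  have hD := isBlockDecomposition Φ hΦ
  obtain ⟨U, hUc, hU⟩ := exists_compact_mem_nhds (0 : S)
  let V : ℕ × ℕ → Set G := fun p => (fun g => Φ (⟨p.1, g, p.2⟩ : ReillySemigroup θ)) ⁻¹' U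
  have hl : ∀ s : S, {p | ¬ V p ⊆
      {g | s * Φ (⟨p.1, g, p.2⟩ : ReillySemigroup θ) ∈ U}}.Finite := fun s => by
    have hs : Continuous (s * ·) := SeparatelyContinuousMul.continuous_const_mul
    exact hD.finite_not_subset hUc (hs.continuousAt.preimage_mem_nhds (by rwa [mul_zero]))
  have hr : ∀ s : S, {p | ¬ V p ⊆
      {g | Φ (⟨p.1, g, p.2⟩ : ReillySemigroup θ) * s ∈ U}}.Finite := fun s => by
    have hs : Continuous (· * s) := SeparatelyContinuousMul.continuous_mul_const
    exact hD.finite_not_subset hUc (hs.continuousAt.preimage_mem_nhds (by rwa [zero_mul]))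
  have h₁ : {p : ℕ × ℕ | V (p.1 + 1, p.2) ≠ V p}.Finite := by
    refine ((hl (Φ (⟨1, 1, 0⟩ : ReillySemigroup θ))).union
      ((hl (Φ (⟨0, 1, 1⟩ : ReillySemigroup θ))).preimage
        (f := fun p : ℕ × ℕ => (p.1 + 1, p.2)) ?_)).subset fun p hp => ?_
    · rintro ⟨a, b⟩ - ⟨a', b'⟩ - h
      simpa using h
    · by_contra hcon
      simp only [mem_union, mem_preimage, mem_ofPred_eq, not_or, not_not, ← map_mul,
        ← WithZero.coe_mul, raise_mul, lower_mul] at hcon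
      exact hp (hcon.2.antisymm hcon.1)
  have h₂ : {p : ℕ × ℕ | V (p.1, p.2 + 1) ≠ V p}.Finite := by
    refine ((hr (Φ (⟨0, 1, 1⟩ : ReillySemigroup θ))).union
      ((hr (Φ (⟨1, 1, 0⟩ : ReillySemigroup θ))).preimage
        (f := fun p : ℕ × ℕ => (p.1, p.2 + 1)) ?_)).subset fun p hp => ?_
    · rintro ⟨a, b⟩ - ⟨a', b'⟩ - h
      simpa using h
    · by_contra hcon
      simp only [mem_union, mem_preimage, mem_ofPred_eq, not_or, not_not, ← map_mul,
        ← WithZero.coe_mul, mul_raise, mul_lower] at hcon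
      exact hp (hcon.2.antisymm hcon.1)
  obtain ⟨A, N, hA⟩ := exists_eq_of_finite_ne V h₁ h₂
  have hfin : {p : ℕ × ℕ | V p ≠ A}.Finite := by
    refine (finite_Iic (N, N)).subset fun p hp => ?_
    by_contra hcon
    refine hp (hA p ?_)
    rw [mem_Iic, Prod.le_def] at hcon
    simp only at hcon
    omega
  -- `A` is empty or everything, being stable under left translations: the single `(0, h, 0)` acts on
  -- the whole row `0` as the left translation by `h`, and almost all traces in that row are `A`.
  have hinv : ∀ h g, g ∈ A → h * g ∈ A := fun h g hg => by
    obtain ⟨j, hj⟩ : ∃ j, (0, N + j) ∉ {p | ¬ V p ⊆ {g | Φ (⟨0, h, 0⟩ : ReillySemigroup θ) *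
        Φ (⟨p.1, g, p.2⟩ : ReillySemigroup θ) ∈ U}} := by
      by_contra! hcon
      refine (infinite_range_of_injective (f := fun j : ℕ => ((0 : ℕ), N + j)) ?_)
        ((hl (Φ (⟨0, h, 0⟩ : ReillySemigroup θ))).subset ?_)
      · intro a b hab
        simpa using hab
      · rintro _ ⟨j, rfl⟩
        exact hcon j
    have hV : V (0, N + j) = A := hA _ (.inr (Nat.le_add_right _ _))
    simp only [mem_ofPred_eq, not_not, ← map_mul, ← WithZero.coe_mul, unit_mul] at hj
    rw [← hV] at hg ⊢
    exact hj hg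
  rcases A.eq_empty_or_nonempty with rfl | ⟨g₀, hg₀⟩
  · left
    filter_upwards [hU, hD.biUnion_range_compl_mem_nhds hfin] with x hxU hx
    by_contra hx0
    obtain ⟨p, g, rfl⟩ := hD.exists_eq x hx0
    refine hx (mem_iUnion₂.2 ⟨p, fun hp => ?_, g, rfl⟩)
    exact (hp ▸ notMem_empty g : g ∉ V p) hxU
  · right
    intro W hW
    refine (hfin.union (hD.finite_not_subset hUc hW)).subset fun p hp => ?_
    by_contra hcon
    simp only [mem_union, mem_ofPred_eq, not_or, not_not] at hcon
    refine hp (eq_univ_of_forall fun g => hcon.2 ?_)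
    change g ∈ V p
    rw [hcon.1]
    simpa using hinv (g * g₀⁻¹) g₀ hg₀

theorem isHomeomorph_symm_or [LocallyCompactSpace S] (Φ : WithZero (ReillySemigroup θ) ≃* S)
    (hΦ : ∀ i j, Continuous fun g => Φ (⟨i, g, j⟩ : ReillySemigroup θ)) :
    @IsHomeomorph S (WithZero (ReillySemigroup θ)) _ (sumTopology θ) Φ.symm ∨
      @IsHomeomorph S (WithZero (ReillySemigroup θ)) _ (acTopology θ) Φ.symm := by
  have hD := isBlockDecomposition Φ hΦ
  have hslice : ∀ (V : Set (WithZero (ReillySemigroup θ))) (p : ℕ × ℕ),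
      (fun g => Φ (⟨p.1, g, p.2⟩ : ReillySemigroup θ)) ⁻¹' (Φ.symm ⁻¹' V) = slice θ V p.1 p.2 := by
    intro V p
    ext g
    simp [slice]
  rcases singleton_zero_mem_nhds_or Φ hΦ with h0 | h0
  · left
    let := sumTopology θ
    refine (Φ.symm.toEquiv.toHomeomorph fun V => ?_).isHomeomorph
    refine (hD.isOpen_iff (W := Φ.symm ⁻¹' V)).trans ⟨fun h i j => ?_, fun h => ⟨fun p => ?_, ?_⟩⟩
    · exact hslice V (i, j) ▸ h.1 (i, j)
    · exact (hslice V p).symm ▸ h p.1 p.2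
    · exact fun hz => mem_of_superset h0 (singleton_subset_iff.2 hz)
  · right
    let := acTopology θ
    refine (Φ.symm.toEquiv.toHomeomorph fun V => ?_).isHomeomorph
    refine (hD.isOpen_iff (W := Φ.symm ⁻¹' V)).trans
      ⟨fun h => ⟨fun i j => ?_, fun hz => ?_⟩, fun h => ⟨fun p => ?_, fun hz => ?_⟩⟩
    · exact hslice V (i, j) ▸ h.1 (i, j)
    · have := h0 _ (h.2 (by simpa using hz))
      simpa only [hslice] using this
    · exact (hslice V p).symm ▸ h.1 p.1 p.2
    · filter_upwards [hD.biUnion_range_compl_mem_nhds (h.2 (by simpa using hz))] with x hx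
      by_cases hx0 : x = 0
      · rwa [hx0]
      · obtain ⟨p, g, rfl⟩ := hD.exists_eq x hx0
        by_contra hg
        refine hx (mem_iUnion₂.2 ⟨p, fun hp => hg ?_, g, rfl⟩)
        have : g ∈ slice θ V p.1 p.2 := hp ▸ mem_univ g
        rwa [← hslice] at this

end ReillySemigroup

/-! ### The classification -/

theorem theorem3p13 {S : Type*} [SemigroupWithZero S] [TopologicalSpace S] [T2Space S]
    [LocallyCompactSpace S] [SeparatelyContinuousMul S]
    (hS : IsZeroBisimpleInverseOmegaSemigroup S)
    (e : S) (he : IsIdempotentElem e) (he0 : e ≠ 0)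
    (hcompact : CompactSpace (MaximalSubgroup he)) :
    IsTopologicalGroup (MaximalSubgroup he) ∧
      ∃ θ : MaximalSubgroup he →* MaximalSubgroup he, Continuous θ ∧
        ∃ φ : S ≃* WithZero (ReillySemigroup θ),
          @IsHomeomorph S (WithZero (ReillySemigroup θ)) _ (ReillySemigroup.sumTopology θ) φ ∨
          @IsHomeomorph S (WithZero (ReillySemigroup θ)) _ (ReillySemigroup.acTopology θ) φ := by
  have hval : Continuous fun g : MaximalSubgroup he => g.1 := continuous_subtype_val
  have hT2 : T2Space (MaximalSubgroup he) := inferInstanceAs (T2Space {x : S // GreenH x e})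
  have hsep : SeparatelyContinuousMul (MaximalSubgroup he) :=
    { continuous_const_mul := fun {a} => Continuous.subtype_mk
        ((SeparatelyContinuousMul.continuous_const_mul (a := a.1)).comp hval) _
      continuous_mul_const := fun {a} => Continuous.subtype_mk
        ((SeparatelyContinuousMul.continuous_mul_const (a := a.1)).comp hval) _ }
  obtain ⟨θ, Φ, ⟨a, b, hθ⟩, hΦ⟩ := hS.exists_reilly_equiv he he0
  have hcont : ∀ a b : S, Continuous fun g : MaximalSubgroup he => a * g.1 * b := fun a b =>
    SeparatelyContinuousMul.continuous_mul_const.comp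
      (SeparatelyContinuousMul.continuous_const_mul.comp hval)
  refine ⟨isTopologicalGroup_of_compactSpace, θ, ?_, Φ.symm,
    ReillySemigroup.isHomeomorph_symm_or Φ fun i j => ?_⟩
  · exact Continuous.subtype_mk (f := fun g => (θ g).1)
      ((hcont a b).congr fun g => (hθ g).symm) fun g => (θ g).2
  · obtain ⟨a, b, h⟩ := hΦ i j
    exact (hcont a b).congr fun g => (h g).symm
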